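/- A group $H$ is called computable if it has a generating set $X=\{x_0,x_1,x_2,\dots\}$, enumerated as a sequence (repetitions allowed), such that the set of words in $(X\cup X^{-1})^*$ (words in the indexed letters $x_i^{\pm1}$) that represent the identity of $H$ is recursive. A finitely generated group $G$ has decidable word problem if, for some (equivalently, every) finite generating set $S$ of $G$, the set of words in $(S\cup S^{-1})^*$ that represent the identity of $G$ is recursive. The membership problem for a subgroup $K\le G$ is decidable if, for some (equivalently, every) finite generating set $S$ of $G$, the set of words in $(S\cup S^{-1})^*$ that represent elements of $K$ is recursive. A subgroup $K\le G$ is subnormal if there is a finite chain of subgroups $K=K_0\trianglelefteq K_1\trianglelefteq\dots\trianglelefteq K_m=G$, each normal in the next. Let $H$ be a countable group. Then the following are equivalent: (1) $H$ is computable; (2) $H$ is isomorphic to a subgroup $K$ of a finitely generated group $G$ with decidable word problem such that the membership problem for $K$ in $G$ is decidable; (3) $H$ is isomorphic to a subnormal subgroup $K$ of a finitely generated group $G$ with decidable word problem such that the membership problem for $K$ in $G$ is decidable. -/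

import Mathlib

universe u v

/-- The element of `G` represented by a word `w ∈ (X ∪ X⁻¹)*` over the generators `X = {x i | i}`:
the letter `(i, true)` stands for `x i` and the letter `(i, false)` for `(x i)⁻¹`. -/
def wordValue {G : Type*} [Group G] {ι : Type*} (x : ι → G) (w : List (ι × Bool)) : G :=
  (w.map fun p => if p.2 then x p.1 else (x p.1)⁻¹).prod

/-- The family `x` generates the group `G`. -/
def GeneratesGroup {G : Type*} [Group G] {ι : Type*} (x : ι → G) : Prop :=
  Subgroup.closure (Set.range x) = ⊤

/-- `G` is computable with respect to the enumerated generating set `X = {x i | i}`: the elements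
`x i` generate `G` and the set `{u ∈ (X ∪ X⁻¹)* | u = 1 in G}` is recursive. -/
def ComputableWithRespectTo {G : Type*} [Group G] {ι : Type*} [Primcodable ι] (x : ι → G) : Prop :=
  GeneratesGroup x ∧ ComputablePred fun w : List (ι × Bool) => wordValue x w = 1

/-- `G` is a computable group: it is computable with respect to some recursively enumerated
generating set `{x 0, x 1, x 2, …}`. Repetitions are allowed, so finite generating sets are
included. -/
def IsComputableGroup (G : Type*) [Group G] : Prop :=
  ∃ x : ℕ → G, ComputableWithRespectTo x

/-- `G` is a finitely generated group with decidable word problem: it is computable with respect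
to some finite generating set. -/
def IsFGWithDecidableWordProblem (G : Type*) [Group G] : Prop :=
  ∃ (n : ℕ) (x : Fin n → G), ComputableWithRespectTo x

/-- The membership problem for the subgroup `K` of the finitely generated group `G` is decidable:
an algorithm decides, for words over a finite generating set of `G`, whether the represented
element lies in `K`. -/
def HasDecidableMembership {G : Type*} [Group G] (K : Subgroup G) : Prop :=
  ∃ (n : ℕ) (x : Fin n → G), GeneratesGroup x ∧
    ComputablePred fun w : List (Fin n × Bool) => wordValue x w ∈ K

/-! ### Computability of list operations -/

section Computability

variable {α β σ : Type*} [Primcodable α] [Primcodable β] [Primcodable σ]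

/-! From a subgroup with decidable membership one recovers a computable group by enumerating the
words that lie in it (`HasDecidableMembership.isComputableGroup`).

Conversely, let `h j` generate `H`, and let `t` be the shift of `H ≀ ℤ` and `f j` the function equal
to `h j` on `n ≥ 0`. Then `[t, f j * t]` is `(h j)⁻¹` at position `0`. In `(H ≀ ℤ) ≀ ℤ` take three
elements: the shift, `t` at position `0`, and the function with value `f j * t` at `j ^ 2`.
Conjugating the last one by a power of the shift brings `f j * t` to position `0`, and a commutator
with the second gives `(h j)⁻¹`. So the generated group contains a copy of `H`, which is subnormal
because a coordinate factor is normal in the base group (`isSubnormal_map_atZero`).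

Decidability: a word determines a final shift and a value at each position, and a value depends only
on a window around the position (`evalAt_eq_map`). Far from `0` the windows repeat: step functions
are constant there, and squares are so sparse that a window meets at most one. There the value is a
power of one `f j * t`, of infinite order, so its triviality depends only on the exponent. Hence
finitely many positions suffice (`IsSupportBound.computablePred`). -/

theorem List.foldl_eq_natRec {β σ : Type*} (h : σ → β → σ) (s : σ) (l : List β) :
    l.foldl h s = Nat.rec (motive := fun _ => σ) s
      (fun k r => Option.casesOn (motive := fun _ => σ) l[k]? r (fun b => h r b)) l.length := by
  suffices H : ∀ k, k ≤ l.length → (l.take k).foldl h s = Nat.rec (motive := fun _ => σ) s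
      (fun k r => Option.casesOn (motive := fun _ => σ) l[k]? r (fun b => h r b)) k by
    simpa using H l.length le_rfl
  intro k
  induction k with
  | zero => simp
  | succ k ih =>
    intro hk
    have hk' : k < l.length := hk
    rw [List.take_add_one, List.foldl_append, ih hk'.le]
    simp [List.getElem?_eq_getElem hk']

/-- Needed beyond primitive recursion, because the substitutions applied to words can depend on a
membership test. -/
theorem Computable.list_foldl {f : α → List β} {g : α → σ} {h : α → σ × β → σ}
    (hf : Computable f) (hg : Computable g) (hh : Computable₂ h) :
    Computable fun a => (f a).foldl (fun s b => h a (s, b)) (g a) := by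
  refine Computable.of_eq (Computable.nat_rec (f := fun a => (f a).length) (g := g)
    (h := fun a p => Option.casesOn (motive := fun _ => σ) (f a)[p.1]? p.2
      (fun b => h a (p.2, b))) (Computable.list_length.comp hf) hg ?_) fun a =>
        (List.foldl_eq_natRec (fun s b => h a (s, b)) (g a) (f a)).symm
  refine Computable.option_casesOn (o := fun q : α × (ℕ × σ) => (f q.1)[q.2.1]?)
    (f := fun q => q.2.2) (g := fun q b => h q.1 (q.2.2, b)) ?_ ?_ ?_
  · exact Computable.list_getElem?.comp (hf.comp Computable.fst)
      (Computable.fst.comp Computable.snd)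
  · exact Computable.snd.comp Computable.snd
  · exact hh.comp (Computable.fst.comp Computable.fst)
      (Computable.pair (Computable.snd.comp (Computable.snd.comp Computable.fst)) Computable.snd)

theorem Computable.list_flatMap {f : α → List β} {g : β → List σ}
    (hf : Computable f) (hg : Computable g) : Computable fun a => (f a).flatMap g := by
  refine (Computable.list_foldl hf (Computable.const ([] : List σ))
    (h := fun _ p => p.1 ++ g p.2) ?_).of_eq fun a => ?_
  · exact Computable.list_append.comp (Computable.fst.comp Computable.snd)
      (hg.comp (Computable.snd.comp Computable.snd))
  · suffices H : ∀ (l : List β) (s : List σ), l.foldl (fun s b => s ++ g b) s = s ++ l.flatMap g by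
      simpa using H (f a) []
    intro l
    induction l with
    | nil => simp
    | cons b l ih => intro s; simp [ih]

theorem ComputablePred.comp {p : β → Prop} {f : α → β} (hp : ComputablePred p)
    (hf : Computable f) : ComputablePred fun a => p (f a) := by
  classical
  exact (hp.decide.comp hf).computablePred

theorem ComputablePred.and {p q : α → Prop} (hp : ComputablePred p) (hq : ComputablePred q) :
    ComputablePred fun a => p a ∧ q a := by
  classical
  refine Computable.computablePred ((Primrec.and.to_comp.comp hp.decide hq.decide).of_eq ?_)
  intro a
  simp

theorem ComputablePred.forall_lt {p : α × ℕ → Prop} {f : α → ℕ} (hp : ComputablePred p)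
    (hf : Computable f) : ComputablePred fun a => ∀ k < f a, p (a, k) := by
  classical
  refine Computable.computablePred (Computable.of_eq (Computable.nat_rec (f := f)
    (g := fun _ => true) (h := fun a q => decide (p (a, q.1)) && q.2) hf (Computable.const _) ?_)
      fun a => ?_)
  · exact Primrec.and.to_comp.comp
      (hp.decide.comp (Computable.pair Computable.fst (Computable.fst.comp Computable.snd)))
      (Computable.snd.comp Computable.snd)
  · induction f a with
    | zero => simp
    | succ n ih =>
      simp only [ih, Nat.forall_lt_succ_right]
      simp [and_comm]

end Computability

/-! ### Words -/

section Words

variable {G : Type*} [Group G] {ι κ : Type*}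

@[simp] theorem wordValue_nil (x : ι → G) : wordValue x [] = 1 := rfl

@[simp] theorem wordValue_cons (x : ι → G) (p : ι × Bool) (w : List (ι × Bool)) :
    wordValue x (p :: w) = (if p.2 then x p.1 else (x p.1)⁻¹) * wordValue x w := by
  simp [wordValue]

@[simp] theorem wordValue_append (x : ι → G) (u w : List (ι × Bool)) :
    wordValue x (u ++ w) = wordValue x u * wordValue x w := by
  simp [wordValue]

/-- The word `w` if `b` is true, and the formal inverse of `w` otherwise. -/
def signedWord (b : Bool) (w : List (ι × Bool)) : List (ι × Bool) :=
  if b then w else (w.map fun p => (p.1, !p.2)).reverse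

theorem wordValue_signedWord (x : ι → G) (b : Bool) (w : List (ι × Bool)) :
    wordValue x (signedWord b w) = if b then wordValue x w else (wordValue x w)⁻¹ := by
  cases b
  · simp only [signedWord, Bool.false_eq_true, if_false]
    induction w with
    | nil => simp
    | cons p w ih =>
      rcases p with ⟨i, _ | _⟩ <;> simp [ih]
  · simp [signedWord]

theorem primrec_signedWord [Primcodable ι] : Primrec₂ (signedWord (ι := ι)) := by
  refine Primrec.ite (Primrec.eq.comp Primrec.fst (Primrec.const true)) Primrec.snd ?_
  refine Primrec.list_reverse.comp (Primrec.list_map Primrec.snd ?_)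
  exact Primrec.pair (Primrec.fst.comp Primrec.snd)
    (Primrec.not.comp (Primrec.snd.comp Primrec.snd))

theorem map_wordValue {G' : Type*} [Group G'] (f : G →* G') (x : ι → G) (w : List (ι × Bool)) :
    f (wordValue x w) = wordValue (fun i => f (x i)) w := by
  induction w with
  | nil => simp
  | cons p w ih => rcases p with ⟨i, _ | _⟩ <;> simp [ih]

/-- Substitute the words `φ i` for the letters of a word. -/
def substWord (φ : ι → List (κ × Bool)) (w : List (ι × Bool)) : List (κ × Bool) :=
  w.flatMap fun p => signedWord p.2 (φ p.1)

theorem wordValue_substWord (x : κ → G) (φ : ι → List (κ × Bool)) (w : List (ι × Bool)) :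
    wordValue x (substWord φ w) = wordValue (fun i => wordValue x (φ i)) w := by
  induction w with
  | nil => simp [substWord]
  | cons p w ih =>
    simp only [substWord] at ih
    simp [substWord, wordValue_signedWord, ih]

theorem computable_substWord [Primcodable ι] [Primcodable κ] {φ : ι → List (κ × Bool)}
    (hφ : Computable φ) : Computable (substWord φ) :=
  Computable.list_flatMap Computable.id
    (primrec_signedWord.to_comp.comp Computable.snd (hφ.comp Computable.fst))

theorem GeneratesGroup.exists_wordValue {x : ι → G} (hx : GeneratesGroup x) (g : G) :
    ∃ w, wordValue x w = g := by
  have hg : g ∈ Subgroup.closure (Set.range x) := by rw [hx]; trivial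
  induction hg using Subgroup.closure_induction with
  | mem y hy =>
    obtain ⟨i, rfl⟩ := hy
    exact ⟨[(i, true)], by simp⟩
  | one => exact ⟨[], rfl⟩
  | mul a b _ _ iha ihb =>
    obtain ⟨u, rfl⟩ := iha
    obtain ⟨v, rfl⟩ := ihb
    exact ⟨u ++ v, by simp⟩
  | inv a _ iha =>
    obtain ⟨u, rfl⟩ := iha
    exact ⟨signedWord false u, by simp [wordValue_signedWord]⟩

theorem GeneratesGroup.map {G' : Type*} [Group G'] {x : ι → G} (hx : GeneratesGroup x)
    {f : G →* G'} (hf : Function.Surjective f) : GeneratesGroup fun i => f (x i) := by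
  have h : Set.range (fun i => f (x i)) = f '' Set.range x := Set.range_comp f x
  rw [GeneratesGroup, h, ← MonoidHom.map_closure, hx, Subgroup.map_top_of_surjective f hf]

theorem ComputableWithRespectTo.map {G' : Type*} [Group G'] [Primcodable ι] {x : ι → G}
    (hx : ComputableWithRespectTo x) (e : G ≃* G') : ComputableWithRespectTo fun i => e (x i) := by
  refine ⟨hx.1.map (f := e.toMonoidHom) e.surjective, hx.2.of_eq fun w => ?_⟩
  rw [← e.map_eq_one_iff]
  exact iff_of_eq (congrArg (· = 1) (map_wordValue e.toMonoidHom x w))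

theorem IsComputableGroup.of_mulEquiv {G' : Type*} [Group G'] (e : G ≃* G')
    (h : IsComputableGroup G) : IsComputableGroup G' := by
  obtain ⟨x, hx⟩ := h
  exact ⟨_, hx.map e⟩

theorem IsFGWithDecidableWordProblem.of_mulEquiv {G' : Type*} [Group G'] (e : G ≃* G')
    (h : IsFGWithDecidableWordProblem G) : IsFGWithDecidableWordProblem G' := by
  obtain ⟨n, x, hx⟩ := h
  exact ⟨n, _, hx.map e⟩

theorem HasDecidableMembership.map {G' : Type*} [Group G'] {K : Subgroup G} (e : G ≃* G')
    (h : HasDecidableMembership K) : HasDecidableMembership (K.map e.toMonoidHom) := by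
  obtain ⟨n, x, hx, hK⟩ := h
  refine ⟨n, fun i => e (x i), hx.map (f := e.toMonoidHom) e.surjective, hK.of_eq fun w => ?_⟩
  rw [← Subgroup.mem_map_iff_mem (f := e.toMonoidHom) e.injective]
  exact iff_of_eq (congrArg (· ∈ K.map e.toMonoidHom) (map_wordValue e.toMonoidHom x w))

theorem IsFGWithDecidableWordProblem.countable (h : IsFGWithDecidableWordProblem G) :
    Countable G := by
  obtain ⟨n, x, hx, -⟩ := h
  exact Function.Surjective.countable (f := wordValue x) hx.exists_wordValue

/-- A subgroup with decidable membership in a group with decidable word problem is computable: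
enumerate the words that represent its elements. -/
theorem HasDecidableMembership.isComputableGroup {K : Subgroup G}
    (hG : IsFGWithDecidableWordProblem G) (hK : HasDecidableMembership K) :
    IsComputableGroup K := by
  classical
  obtain ⟨n, x, hxgen, hwp⟩ := hG
  obtain ⟨m, y, hy, hmem⟩ := hK
  choose ψ hψ using fun j => hxgen.exists_wordValue (y j)
  have hyψ : y = fun j => wordValue x (ψ j) := funext fun j => (hψ j).symm
  have hsubst : ∀ w, wordValue x (substWord ψ w) = wordValue y w := fun w => by
    rw [wordValue_substWord, ← hyψ]
  let e : ℕ → List (Fin m × Bool) := fun i => (Encodable.decode i).getD []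
  have he : Computable e := Computable.option_getD Computable.decode (Computable.const [])
  -- Words outside `K` are replaced by the empty word, so that every index yields an element of `K`.
  let φ : ℕ → List (Fin m × Bool) := fun i => if wordValue y (e i) ∈ K then e i else []
  have hφ : Computable φ := by
    refine (Computable.cond (hmem.decide.comp he) he (Computable.const [])).of_eq fun i => ?_
    by_cases h : wordValue y (e i) ∈ K <;> simp [φ, h]
  have hφK : ∀ i, wordValue y (φ i) ∈ K := fun i => by
    by_cases h : wordValue y (e i) ∈ K <;> simp [φ, h]
  let z : ℕ → K := fun i => ⟨wordValue y (φ i), hφK i⟩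
  have hz : ∀ u, ((wordValue z u : K) : G) = wordValue y (substWord φ u) := fun u => by
    rw [wordValue_substWord]
    exact map_wordValue K.subtype z u
  refine ⟨z, ?_, ?_⟩
  · refine eq_top_iff.2 fun k _ => Subgroup.subset_closure ?_
    obtain ⟨w, hw⟩ := hy.exists_wordValue (k : G)
    refine ⟨Encodable.encode w, Subtype.ext ?_⟩
    simp [z, φ, e, hw]
  · refine (hwp.comp ((computable_substWord (Primrec.dom_finite ψ).to_comp).comp
      (computable_substWord hφ))).of_eq fun u => ?_
    rw [hsubst, ← hz]
    simp

end Words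

/-! ### Words in wreath products with `ℤ` -/

section Wreath

open RegularWreathProduct

variable {A B : Type*} [Group A] [Group B] {ι κ : Type*}

/-- The generators of a subgroup of `A ≀ ℤ`: the shift, and the functions `F i : ℤ → A`. -/
def wreathGen (F : ι → ℤ → A) : Option ι → A ≀ᵣ Multiplicative ℤ
  | none => inl (Multiplicative.ofAdd 1)
  | some i => ⟨fun q => F i q.toAdd, 1⟩

/-- The position read after a shift letter. -/
def shiftPos (b : Bool) (c : ℤ) : ℤ := if b then c - 1 else c + 1

/-- The value at position `c` of the function part of the element represented by a word. -/
def evalAt (F : ι → ℤ → A) : List (Option ι × Bool) → ℤ → A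
  | [], _ => 1
  | (none, b) :: w, c => evalAt F w (shiftPos b c)
  | (some i, b) :: w, c => (if b then F i c else (F i c)⁻¹) * evalAt F w c

/-- The position reached from `c` at the end of a word. -/
def endPos : List (Option ι × Bool) → ℤ → ℤ
  | [], c => c
  | (none, b) :: w, c => endPos w (shiftPos b c)
  | (some _, _) :: w, c => endPos w c

theorem wordValue_wreathGen_left (F : ι → ℤ → A) (w : List (Option ι × Bool)) (c : ℤ) :
    (wordValue (wreathGen F) w).left (Multiplicative.ofAdd c) = evalAt F w c := by
  induction w generalizing c with
  | nil => rfl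
  | cons p w ih =>
    rcases p with ⟨_ | i, _ | _⟩
    · simp [wreathGen, evalAt, ← ih, shiftPos, ofAdd_add, mul_comm]
    · simp [wreathGen, evalAt, ← ih, shiftPos, ofAdd_sub, div_eq_mul_inv, mul_comm]
    · simp [wreathGen, evalAt, ← ih]
    · simp [wreathGen, evalAt, ← ih]

theorem wordValue_wreathGen_right (F : ι → ℤ → A) (w : List (Option ι × Bool)) (c : ℤ) :
    (wordValue (wreathGen F) w).right.toAdd = c - endPos w c := by
  induction w generalizing c with
  | nil => simp [endPos]
  | cons p w ih =>
    rcases p with ⟨_ | i, _ | _⟩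
    · simp only [wordValue_cons, mul_right, toAdd_mul, ih (shiftPos false c), endPos]
      simp [wreathGen, shiftPos]
      ring
    · simp only [wordValue_cons, mul_right, toAdd_mul, ih (shiftPos true c), endPos]
      simp [wreathGen, shiftPos]
      ring
    · simp [wreathGen, endPos, ih c]
    · simp [wreathGen, endPos, ih c]

/-- Each letter moves the position by at most one, so only values within the word's length of the
start are read. The two centres and `θ` allow windows to be compared across positions and groups. -/
theorem evalAt_eq_map (θ : B →* A) {F : ι → ℤ → A} {E : ι → ℤ → B} (w : List (Option ι × Bool))
    {c c' : ℤ} (h : ∀ i d, |d| ≤ (w.length : ℤ) → F i (c + d) = θ (E i (c' + d))) :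
    evalAt F w c = θ (evalAt E w c') := by
  induction w generalizing c c' with
  | nil => simp [evalAt]
  | cons p w ih =>
    have hlen : ((p :: w).length : ℤ) = w.length + 1 := by simp
    rw [hlen] at h
    rcases p with ⟨_ | i, b⟩
    · refine ih fun i d hd => ?_
      rcases b with _ | _
      · have := h i (d + 1) ((abs_add_le d 1).trans (by simpa using hd))
        simpa [shiftPos, add_assoc, add_comm 1 d] using this
      · have := h i (d - 1) ((abs_sub d 1).trans (by simpa using hd))
        simpa [shiftPos, sub_eq_add_neg, add_assoc, add_comm (-1) d] using this
    · have h0 : F i c = θ (E i c') := by simpa using h i 0 (by simp; positivity)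
      have hw := ih fun i d hd => h i d (hd.trans (by simp))
      rcases b with _ | _ <;> simp [evalAt, h0, hw]

theorem evalAt_eq_one {F : ι → ℤ → A} (w : List (Option ι × Bool)) {c : ℤ}
    (h : ∀ i d, |d| ≤ (w.length : ℤ) → F i (c + d) = 1) : evalAt F w c = 1 := by
  simpa using evalAt_eq_map (1 : A →* A) (E := F) (c' := 0) w (by simpa using h)

/-- Integer positions are represented by pairs `(p, m)`, standing for `p - m`. -/
def shiftPair (b : Bool) (c : ℕ × ℕ) : ℕ × ℕ := if b then (c.1, c.2 + 1) else (c.1 + 1, c.2)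

/-- One step of reading a word in a wreath product: update the position and the word that
represents the value. -/
def readStep (φ : ι → ℕ × ℕ → List (κ × Bool)) (s : (ℕ × ℕ) × List (κ × Bool))
    (p : Option ι × Bool) : (ℕ × ℕ) × List (κ × Bool) :=
  Option.casesOn p.1 (shiftPair p.2 s.1, s.2)
    fun i => (s.1, s.2 ++ signedWord p.2 (φ i s.1))

/-- Read a word in a wreath product, starting at a given position. -/
def readWord (φ : ι → ℕ × ℕ → List (κ × Bool)) (w : List (Option ι × Bool)) (c : ℕ × ℕ) :
    (ℕ × ℕ) × List (κ × Bool) :=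
  w.foldl (readStep φ) (c, [])

theorem cast_shiftPair (b : Bool) (c : ℕ × ℕ) :
    (((shiftPair b c).1 : ℤ) - (shiftPair b c).2) = shiftPos b (c.1 - c.2) := by
  cases b <;> simp [shiftPair, shiftPos] <;> ring

theorem foldl_readStep {φ : ι → ℕ × ℕ → List (κ × Bool)} {x : κ → A} {F : ι → ℤ → A}
    (h : ∀ i c, wordValue x (φ i c) = F i (c.1 - c.2)) (w : List (Option ι × Bool))
    (c : ℕ × ℕ) (u : List (κ × Bool)) :
    ((w.foldl (readStep φ) (c, u)).1.1 : ℤ) - (w.foldl (readStep φ) (c, u)).1.2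
        = endPos w (c.1 - c.2) ∧
      wordValue x (w.foldl (readStep φ) (c, u)).2 = wordValue x u * evalAt F w (c.1 - c.2) := by
  induction w generalizing c u with
  | nil => simp [endPos, evalAt]
  | cons p w ih =>
    rcases p with ⟨_ | i, b⟩
    · simpa [endPos, evalAt, readStep, ← cast_shiftPair] using ih (shiftPair b c) u
    · simpa [endPos, evalAt, readStep, wordValue_signedWord, h, mul_assoc] using
        ih c (u ++ signedWord b (φ i c))

theorem readWord_fst {φ : ι → ℕ × ℕ → List (κ × Bool)} {x : κ → A} {F : ι → ℤ → A}
    (h : ∀ i c, wordValue x (φ i c) = F i (c.1 - c.2)) (w : List (Option ι × Bool))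
    (c : ℕ × ℕ) :
    ((readWord φ w c).1.1 : ℤ) - (readWord φ w c).1.2 = endPos w (c.1 - c.2) :=
  (foldl_readStep h w c []).1

theorem wordValue_readWord_snd {φ : ι → ℕ × ℕ → List (κ × Bool)} {x : κ → A} {F : ι → ℤ → A}
    (h : ∀ i c, wordValue x (φ i c) = F i (c.1 - c.2)) (w : List (Option ι × Bool))
    (c : ℕ × ℕ) : wordValue x (readWord φ w c).2 = evalAt F w (c.1 - c.2) := by
  simpa [readWord] using (foldl_readStep h w c []).2

theorem primrec_readWord [Primcodable ι] [Primcodable κ] {φ : ι → ℕ × ℕ → List (κ × Bool)}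
    (hφ : Primrec₂ φ) : Primrec₂ (readWord φ) := by
  refine Primrec.list_foldl (h := fun _ q => readStep φ q.1 q.2) Primrec.fst
    (Primrec.pair Primrec.snd (Primrec.const [])) ?_
  have hs : Primrec₂ shiftPair :=
    Primrec.ite (Primrec.eq.comp Primrec.fst (Primrec.const true))
      (Primrec.pair (Primrec.fst.comp Primrec.snd)
        (Primrec.succ.comp (Primrec.snd.comp Primrec.snd)))
      (Primrec.pair (Primrec.succ.comp (Primrec.fst.comp Primrec.snd))
        (Primrec.snd.comp Primrec.snd))
  have hstep : Primrec₂ (readStep φ) := by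
    refine Primrec.option_casesOn (Primrec.fst.comp Primrec.snd)
      (Primrec.pair (hs.comp (Primrec.snd.comp Primrec.snd) (Primrec.fst.comp Primrec.fst))
        (Primrec.snd.comp Primrec.fst)) ?_
    have h1 : Primrec fun q : (((ℕ × ℕ) × List (κ × Bool)) × (Option ι × Bool)) × ι =>
        q.1.1.1 := Primrec.fst.comp (Primrec.fst.comp Primrec.fst)
    exact Primrec.pair h1 (Primrec.list_append.comp
      (Primrec.snd.comp (Primrec.fst.comp Primrec.fst))
      (primrec_signedWord.comp (Primrec.snd.comp (Primrec.snd.comp Primrec.fst))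
        (hφ.comp Primrec.snd h1)))
  exact hstep.comp (Primrec.fst.comp Primrec.snd) (Primrec.snd.comp Primrec.snd)

/-- The embedding of `A` into `A ≀ ℤ` as the factor at position `0`. -/
def atZero (A : Type*) [Group A] : A →* A ≀ᵣ Multiplicative ℤ where
  toFun a := ⟨Pi.mulSingle 1 a, 1⟩
  map_one' := by ext <;> simp
  map_mul' a b := by
    ext
    · simp [Pi.mulSingle_mul]
    · simp

@[simp] theorem atZero_left (a : A) : (atZero A a).left = Pi.mulSingle 1 a := rfl

@[simp] theorem atZero_right (a : A) : (atZero A a).right = 1 := rfl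

theorem atZero_injective : Function.Injective (atZero A) := fun a b h => by
  simpa using congrArg (fun v => RegularWreathProduct.left v 1) h

theorem mem_map_atZero {M : Subgroup A} {v : A ≀ᵣ Multiplicative ℤ} :
    v ∈ M.map (atZero A) ↔
      v.right = 1 ∧ (∀ n : ℤ, n ≠ 0 → v.left (Multiplicative.ofAdd n) = 1) ∧ v.left 1 ∈ M := by
  constructor
  · rintro ⟨a, ha, rfl⟩
    refine ⟨rfl, fun n hn => ?_, by simpa using ha⟩
    exact Pi.mulSingle_eq_of_ne (M := fun _ => A) (by simpa using hn) a
  · rintro ⟨h1, h2, h3⟩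
    refine ⟨_, h3, ?_⟩
    ext q
    · by_cases hq : q = 1
      · subst hq; simp
      · rw [atZero_left, Pi.mulSingle_eq_of_ne hq]
        exact (h2 q.toAdd (by simpa using hq)).symm
    · simp [h1]

/-- A bound for the positions at which a word must be evaluated, in terms of its length, in order
to decide that it is trivial away from `0`. -/
def IsSupportBound (F : ι → ℤ → A) (N : ℕ → ℕ) : Prop :=
  ∀ w : List (Option ι × Bool), (∀ n : ℤ, n ≠ 0 → |n| ≤ N w.length → evalAt F w n = 1) →
    ∀ n : ℤ, n ≠ 0 → evalAt F w n = 1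

/-- An arbitrary `M` at position `0` lets the criterion be iterated through both wreath products:
`⊥` gives the word problem, `⊤` membership in the copy of the group. -/
theorem IsSupportBound.wordValue_mem_iff {F : ι → ℤ → A} {N : ℕ → ℕ} (hN : IsSupportBound F N)
    {φ : ι → ℕ × ℕ → List (κ × Bool)} {x : κ → A}
    (h : ∀ i c, wordValue x (φ i c) = F i (c.1 - c.2)) (M : Subgroup A)
    (w : List (Option ι × Bool)) :
    wordValue (wreathGen F) w ∈ M.map (atZero A) ↔
      (readWord φ w (0, 0)).1.1 = (readWord φ w (0, 0)).1.2 ∧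
      (∀ k < N w.length, wordValue x (readWord φ w (k + 1, 0)).2 = 1 ∧
        wordValue x (readWord φ w (0, k + 1)).2 = 1) ∧
      wordValue x (readWord φ w (0, 0)).2 ∈ M := by
  rw [mem_map_atZero, ← toAdd_eq_zero, wordValue_wreathGen_right F w 0]
  simp only [wordValue_wreathGen_left, wordValue_readWord_snd h]
  refine and_congr ?_ (and_congr ⟨fun H k _ => ⟨H _ ?_, H _ ?_⟩, fun H => hN w ?_⟩ ?_)
  · have := readWord_fst h w (0, 0)
    simp only [Nat.cast_zero, sub_zero] at this
    rw [← this]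
    omega
  · push_cast; omega
  · push_cast; omega
  · intro n hn hle
    obtain ⟨k, hk⟩ : ∃ k : ℕ, n.natAbs = k + 1 := ⟨n.natAbs - 1, by omega⟩
    have hkN : k < N w.length := by rw [Int.abs_eq_natAbs] at hle; omega
    rcases le_total 0 n with h0 | h0
    · have := (H k hkN).1
      have hn' : n = ((k + 1 : ℕ) : ℤ) - ((0 : ℕ) : ℤ) := by omega
      rwa [hn']
    · have := (H k hkN).2
      have hn' : n = ((0 : ℕ) : ℤ) - ((k + 1 : ℕ) : ℤ) := by omega
      rwa [hn']
  · have := wordValue_wreathGen_left F w 0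
    rw [ofAdd_zero] at this
    simp [this]

theorem IsSupportBound.computablePred [Primcodable ι] [Primcodable κ] {F : ι → ℤ → A}
    {N : ℕ → ℕ} (hN : IsSupportBound F N) (hNp : Primrec N)
    {φ : ι → ℕ × ℕ → List (κ × Bool)} (hφ : Primrec₂ φ) {x : κ → A}
    (h : ∀ i c, wordValue x (φ i c) = F i (c.1 - c.2))
    (hx : ComputablePred fun w => wordValue x w = 1) {M : Subgroup A}
    (hM : ComputablePred fun w => wordValue x w ∈ M) :
    ComputablePred fun w => wordValue (wreathGen F) w ∈ M.map (atZero A) := by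
  refine ComputablePred.of_eq ?_ fun w => (hN.wordValue_mem_iff h M w).symm
  have hr := primrec_readWord hφ
  have hr0 := hr.comp Primrec.id (Primrec.const (0, 0))
  refine ComputablePred.and ?_ (ComputablePred.and ?_ ?_)
  · exact (Primrec.eq.comp (Primrec.fst.comp (Primrec.fst.comp hr0))
      (Primrec.snd.comp (Primrec.fst.comp hr0))).computablePred
  · refine ComputablePred.forall_lt
      (p := fun q : List (Option ι × Bool) × ℕ => wordValue x (readWord φ q.1 (q.2 + 1, 0)).2 = 1 ∧
        wordValue x (readWord φ q.1 (0, q.2 + 1)).2 = 1) ?_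
      (hNp.comp Primrec.list_length).to_comp
    refine ComputablePred.and
      (hx.comp (f := fun q : List (Option ι × Bool) × ℕ => (readWord φ q.1 (q.2 + 1, 0)).2) ?_)
      (hx.comp (f := fun q : List (Option ι × Bool) × ℕ => (readWord φ q.1 (0, q.2 + 1)).2) ?_)
    · exact (Primrec.snd.comp (hr.comp Primrec.fst
        (Primrec.pair (Primrec.succ.comp Primrec.snd) (Primrec.const 0)))).to_comp
    · exact (Primrec.snd.comp (hr.comp Primrec.fst
        (Primrec.pair (Primrec.const 0) (Primrec.succ.comp Primrec.snd)))).to_comp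
  · exact hM.comp (Primrec.snd.comp hr0).to_comp

end Wreath

/-! ### Subnormality of the factor at position `0` -/

section Subnormal

open RegularWreathProduct

variable {A : Type*} [Group A]

/-- Evaluation at `0` on the base group of `A ≀ ℤ`. -/
def evalZero (A : Type*) [Group A] :
    (rightHom : A ≀ᵣ Multiplicative ℤ →* Multiplicative ℤ).ker →* A where
  toFun v := v.1.left 1
  map_one' := rfl
  map_mul' v w := by
    have hv : v.1.right = 1 := v.2
    simp [hv]

/-- Inside the base group, the image of `S` is the intersection of the whole factor at `0`, which is
normal, with the preimage of `S` under evaluation at `0`. -/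
theorem isSubnormal_map_atZero {S : Subgroup A} (hS : S.IsSubnormal) :
    (S.map (atZero A)).IsSubnormal := by
  have hle : S.map (atZero A) ≤ (rightHom : A ≀ᵣ Multiplicative ℤ →* Multiplicative ℤ).ker := by
    rintro _ ⟨a, -, rfl⟩
    rfl
  refine Subgroup.IsSubnormal.trans hle ?_
    (MonoidHom.normal_ker _).isSubnormal
  have hnormal : (((⊤ : Subgroup A).map (atZero A)).subgroupOf
      (rightHom : A ≀ᵣ Multiplicative ℤ →* Multiplicative ℤ).ker).Normal := by
    refine ⟨fun v hv g => ?_⟩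
    have hg : g.1.right = 1 := g.2
    have hv1 : v.1.right = 1 := v.2
    rw [Subgroup.mem_subgroupOf, mem_map_atZero] at hv ⊢
    refine ⟨by simp [hg, hv1], fun n hn => ?_, trivial⟩
    have := hv.2.1 n hn
    simp [hg, hv1, this]
  convert hnormal.isSubnormal.inf (hS.comap (evalZero A)) using 1
  ext v
  simp only [Subgroup.mem_subgroupOf, Subgroup.mem_inf, Subgroup.mem_comap, mem_map_atZero,
    Subgroup.mem_top, and_true, and_assoc]
  rfl

end Subnormal

/-! ### The two-step embedding -/

section Embedding

open RegularWreathProduct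

open scoped commutatorElement

variable {H A : Type*} [Group H] [Group A]

/-! ### Step functions: the inner wreath product -/

/-- The functions that take a generator as constant value on `n ≥ 0`, and `1` elsewhere. -/
def stepFun (h : ℕ → H) (i : ℕ) (n : ℤ) : H := if 0 ≤ n then h i else 1

theorem isSupportBound_stepFun (h : ℕ → H) : IsSupportBound (stepFun h) (· + 1) := by
  intro w hw n hn
  by_cases hle : |n| ≤ (w.length + 1 : ℕ)
  · exact hw n hn hle
  rcases lt_or_gt_of_ne hn with h0 | h0
  · refine evalAt_eq_one w fun i d hd => if_neg ?_
    rw [abs_of_neg h0] at hle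
    rw [abs_le] at hd
    push_cast at hle
    omega
  · rw [abs_of_pos h0] at hle
    push_cast at hle
    -- The window around `w.length + 1` lies in the positive half-line, like that around `n`. The `+
    -- 1` keeps the test position nonzero even for the empty word.
    have h1 := hw (w.length + 1) (by omega) (by rw [abs_of_pos (by omega)]; simp)
    rw [← h1]
    refine evalAt_eq_map (MonoidHom.id H) w fun i d hd => ?_
    rw [abs_le] at hd
    rw [stepFun, if_pos (by omega), MonoidHom.id_apply, stepFun, if_pos (by omega)]

/-- Words for the values of `stepFun`. -/
def stepWord (i : ℕ) (c : ℕ × ℕ) : List (ℕ × Bool) := if c.2 ≤ c.1 then [(i, true)] else []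

theorem primrec_stepWord : Primrec₂ stepWord :=
  Primrec.ite (Primrec.nat_le.comp (Primrec.snd.comp Primrec.snd) (Primrec.fst.comp Primrec.snd))
    (Primrec.list_cons.comp (Primrec.pair Primrec.fst (Primrec.const true)) (Primrec.const []))
    (Primrec.const [])

theorem wordValue_stepWord (h : ℕ → H) (i : ℕ) (c : ℕ × ℕ) :
    wordValue h (stepWord i c) = stepFun h i (c.1 - c.2) := by
  by_cases hc : c.2 ≤ c.1 <;> simp [stepWord, stepFun, hc]

/-! ### Functions supported on squares: the outer wreath product -/

/-- The function that is `s` at position `0`, and the function that is `g j` at position `j ^ 2`. -/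
def sparseFun (s : A) (g : ℕ → A) : Bool → ℤ → A
  | true, n => if n = 0 then s else 1
  | false, n => if ((n.toNat.sqrt * n.toNat.sqrt : ℕ) : ℤ) = n then g n.toNat.sqrt else 1

theorem sparseFun_false_sq (s : A) (g : ℕ → A) (j : ℕ) :
    sparseFun s g false ((j * j : ℕ) : ℤ) = g j := by
  simp only [sparseFun, Int.toNat_natCast, Nat.sqrt_eq, if_true]

theorem sparseFun_false_of_forall_ne {s : A} {g : ℕ → A} {n : ℤ}
    (h : ∀ j : ℕ, ((j * j : ℕ) : ℤ) ≠ n) : sparseFun s g false n = 1 :=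
  if_neg (h _)

/-- The exponent of the letter `false` at position `k`. -/
def indicatorFun (k : ℤ) : Bool → ℤ → Multiplicative ℤ
  | true, _ => 1
  | false, n => if n = k then Multiplicative.ofAdd 1 else 1

/-- The gaps on either side of `j ^ 2` are at least `2 * j - 1 > 2 * l`. -/
theorem eq_of_abs_sq_sub_sq_le {l i j : ℕ} (hj : l + 1 ≤ j)
    (h : |((i * i : ℕ) : ℤ) - ((j * j : ℕ) : ℤ)| ≤ 2 * l) : i = j := by
  rw [abs_le] at h
  push_cast at h
  rcases lt_trichotomy i j with hij | hij | hij
  · have h1 : (i : ℤ) + 1 ≤ j := by exact_mod_cast hij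
    have h2 : (l : ℤ) + 1 ≤ j := by exact_mod_cast hj
    nlinarith
  · exact hij
  · have h1 : (j : ℤ) + 1 ≤ i := by exact_mod_cast hij
    have h2 : (l : ℤ) + 1 ≤ j := by exact_mod_cast hj
    nlinarith

/-- The window avoids `0` and contains the single square `j ^ 2`, at offset `k`. So the value is a
power of `g j` whose exponent does not depend on `j`. -/
theorem evalAt_sparseFun (s : A) (g : ℕ → A) (w : List (Option Bool × Bool)) {j : ℕ}
    (hj : w.length + 1 ≤ j) {k : ℤ} (hk : |k| ≤ w.length) :
    evalAt (sparseFun s g) w (((j * j : ℕ) : ℤ) - k) =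
      zpowersHom A (g j) (evalAt (indicatorFun k) w 0) := by
  refine evalAt_eq_map _ w fun i d hd => ?_
  have hsq : (w.length : ℤ) + w.length < ((j * j : ℕ) : ℤ) := by
    have : (w.length : ℤ) + 1 ≤ j := by exact_mod_cast hj
    push_cast
    nlinarith
  rw [abs_le] at hk hd
  cases i with
  | true =>
    rw [sparseFun, if_neg (by omega)]
    simp [indicatorFun]
  | false =>
    by_cases hdk : d = k
    · subst hdk
      rw [sub_add_cancel, sparseFun_false_sq]
      simp [indicatorFun]
    · rw [sparseFun_false_of_forall_ne]
      · simp [indicatorFun, hdk]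
      · intro i hi
        have : i = j := eq_of_abs_sq_sub_sq_le hj (by rw [hi, abs_le]; omega)
        subst this
        omega

theorem isSupportBound_sparseFun (s : A) {g : ℕ → A}
    (hg : ∀ j, Function.Injective (zpowersHom A (g j))) :
    IsSupportBound (sparseFun s g) (fun l => (l + 1) * (l + 1) + l) := by
  intro w hw n hn
  by_cases hle : |n| ≤ ((w.length + 1) * (w.length + 1) + w.length : ℕ)
  · exact hw n hn hle
  have hsq : (w.length : ℤ) + w.length < (((w.length + 1) * (w.length + 1) : ℕ) : ℤ) := by
    push_cast
    nlinarith
  have hcast : (((w.length + 1) * (w.length + 1) + w.length : ℕ) : ℤ)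
      = (((w.length + 1) * (w.length + 1) : ℕ) : ℤ) + w.length := Nat.cast_add _ _
  rw [hcast] at hle
  rw [Int.abs_eq_natAbs] at hle
  by_cases hex : ∃ j : ℕ, |((j * j : ℕ) : ℤ) - n| ≤ w.length
  · obtain ⟨j, hj⟩ := hex
    have hj' := abs_le.1 hj
    have hlj : w.length + 1 ≤ j := by
      by_contra hlt
      have h1 : j * j ≤ (w.length + 1) * (w.length + 1) :=
        Nat.mul_le_mul (by omega) (by omega)
      omega
    have hn' : n = ((j * j : ℕ) : ℤ) - (((j * j : ℕ) : ℤ) - n) := by omega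
    rw [hn', evalAt_sparseFun s g w hlj hj]
    -- Compare with the same offset from the square of `w.length + 1`, a tested position.
    -- Injectivity turns triviality there into vanishing of the common exponent.
    have h0 := hw ((((w.length + 1) * (w.length + 1) : ℕ) : ℤ) - (((j * j : ℕ) : ℤ) - n))
      (by omega) (by rw [hcast, abs_le]; omega)
    rw [evalAt_sparseFun s g w le_rfl hj] at h0
    rw [(injective_iff_map_eq_one _).1 (hg _) _ h0, map_one]
  · refine evalAt_eq_one w fun i d hd => ?_
    rw [abs_le] at hd
    cases i with
    | true => exact if_neg (by omega)
    | false =>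
      refine sparseFun_false_of_forall_ne fun j hj => hex ⟨j, ?_⟩
      rw [hj, abs_le]
      omega

/-- Words for the values of `sparseFun`. -/
def sparseWord {κ : Type*} (u : List (κ × Bool)) (v : ℕ → List (κ × Bool)) (b : Bool)
    (c : ℕ × ℕ) : List (κ × Bool) :=
  if b = true then if c.1 = c.2 then u else []
  else if (c.1 - c.2).sqrt * (c.1 - c.2).sqrt + c.2 = c.1 then v (c.1 - c.2).sqrt else []

theorem primrec_sparseWord {κ : Type*} [Primcodable κ] (u : List (κ × Bool))
    {v : ℕ → List (κ × Bool)} (hv : Primrec v) : Primrec₂ (sparseWord u v) := by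
  have h1 : Primrec fun q : Bool × (ℕ × ℕ) => q.2.1 := Primrec.fst.comp Primrec.snd
  have h2 : Primrec fun q : Bool × (ℕ × ℕ) => q.2.2 := Primrec.snd.comp Primrec.snd
  have hs : Primrec fun q : Bool × (ℕ × ℕ) => (q.2.1 - q.2.2).sqrt :=
    Primrec.nat_sqrt.comp (Primrec.nat_sub.comp h1 h2)
  refine Primrec.ite (Primrec.eq.comp Primrec.fst (Primrec.const true))
    (Primrec.ite (Primrec.eq.comp h1 h2) (Primrec.const _) (Primrec.const _))
    (Primrec.ite (Primrec.eq.comp (Primrec.nat_add.comp (Primrec.nat_mul.comp hs hs) h2) h1)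
      (hv.comp hs) (Primrec.const _))

theorem wordValue_sparseWord {κ : Type*} {x : κ → A} {s : A} {g : ℕ → A} {u : List (κ × Bool)}
    {v : ℕ → List (κ × Bool)} (hu : wordValue x u = s) (hv : ∀ j, wordValue x (v j) = g j)
    (b : Bool) (c : ℕ × ℕ) :
    wordValue x (sparseWord u v b c) = sparseFun s g b (c.1 - c.2) := by
  cases b with
  | true =>
    by_cases hc : c.1 = c.2
    · simp [sparseWord, sparseFun, hc, hu]
    · rw [sparseWord, if_pos rfl, if_neg hc, sparseFun, if_neg (by omega), wordValue_nil]
  | false =>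
    have h1 : ((c.1 : ℤ) - c.2).toNat = c.1 - c.2 := by omega
    by_cases hc : (c.1 - c.2).sqrt * (c.1 - c.2).sqrt + c.2 = c.1
    · rw [sparseWord, if_neg (by simp), if_pos hc, sparseFun, h1, if_pos (by omega), hv]
    · rw [sparseWord, if_neg (by simp), if_neg hc, sparseFun, h1, if_neg (by omega),
        wordValue_nil]

/-- Base group elements multiply coordinatewise, so only the value of `v` at `0` matters. -/
theorem commutator_atZero (s : A) {v : A ≀ᵣ Multiplicative ℤ} (hv : v.right = 1) :
    ⁅atZero A s, v⁆ = atZero A ⁅s, v.left 1⁆ := by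
  ext q
  · by_cases hq : q = 1
    · subst hq
      simp [commutatorElement_def, hv]
    · simp [commutatorElement_def, hv, Pi.mulSingle_eq_of_ne (M := fun _ => A) hq]
  · simp [commutatorElement_def, hv]

/-! ### The three generators and the commutator trick -/

/-- The product of a step function and the shift. -/
def stepShift (h : ℕ → H) (j : ℕ) : H ≀ᵣ Multiplicative ℤ :=
  wreathGen (stepFun h) (some j) * wreathGen (stepFun h) none

/-- The shift factor cancels. What remains is the translated step function divided by the original,
and these differ only at `0`. -/
theorem commutator_shift_stepShift (h : ℕ → H) (j : ℕ) :
    ⁅wreathGen (stepFun h) none, stepShift h j⁆ = atZero H (h j)⁻¹ := by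
  have : ⁅wreathGen (stepFun h) none, stepShift h j⁆ = wreathGen (stepFun h) none *
      wreathGen (stepFun h) (some j) * (wreathGen (stepFun h) none)⁻¹ *
        (wreathGen (stepFun h) (some j))⁻¹ := by
    simp [commutatorElement_def, stepShift, mul_assoc]
  rw [this]
  ext q
  · simp only [wreathGen, mul_left, inv_left, mul_right, inv_right, left_inl, right_inl,
      Pi.mul_apply, Pi.inv_apply, Pi.one_apply, atZero_left, stepFun]
    by_cases hq : q = 1
    · subst hq
      simp
    · rw [Pi.mulSingle_eq_of_ne (M := fun _ => H) hq]
      have hq' : q.toAdd ≠ 0 := by simpa using hq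
      by_cases h0 : 0 ≤ q.toAdd
      · have h1 : 0 ≤ -1 + q.toAdd := by omega
        simp [h0, h1]
      · have h1 : ¬ 0 ≤ -1 + q.toAdd := by omega
        simp [h0, h1]
  · simp [wreathGen]

/-- The reason for multiplying the step function by the shift: its projection to `ℤ` is `1`, so all
these elements have infinite order. -/
theorem zpowersHom_stepShift_injective (h : ℕ → H) (j : ℕ) :
    Function.Injective (zpowersHom _ (stepShift h j)) := by
  have hcomp : (rightHom.comp (zpowersHom _ (stepShift h j))) = MonoidHom.id _ := by
    ext
    simp [stepShift, wreathGen]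
  exact Function.Injective.of_comp (f := rightHom)
    (by rw [← MonoidHom.coe_comp, hcomp]; exact Function.injective_id)

/-- Three elements that generate a subgroup of `(H ≀ ℤ) ≀ ℤ` containing a copy of `H`. -/
def threeGen (h : ℕ → H) :
    Option Bool → (H ≀ᵣ Multiplicative ℤ) ≀ᵣ Multiplicative ℤ :=
  wreathGen (sparseFun (wreathGen (stepFun h) none) (stepShift h))

theorem computablePred_threeGen {h : ℕ → H} (hwp : ComputablePred fun w => wordValue h w = 1)
    {M : Subgroup H} (hM : ComputablePred fun w => wordValue h w ∈ M) :
    ComputablePred fun w => wordValue (threeGen h) w ∈ (M.map (atZero H)).map (atZero _) := by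
  have hstep : ∀ {M : Subgroup H}, (ComputablePred fun w => wordValue h w ∈ M) →
      ComputablePred fun w => wordValue (wreathGen (stepFun h)) w ∈ M.map (atZero H) := fun hM =>
    (isSupportBound_stepFun h).computablePred Primrec.succ primrec_stepWord
      (wordValue_stepWord h) hwp hM
  refine (isSupportBound_sparseFun (wreathGen (stepFun h) none)
    (zpowersHom_stepShift_injective h)).computablePred ?_
    (primrec_sparseWord [(none, true)]
      (v := fun j => [(some j, true), (none, true)]) ?_) (wordValue_sparseWord ?_ fun j => ?_)
    ((hstep (M := ⊥) (by simpa using hwp)).of_eq fun w => by simp) (hstep hM)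
  · exact Primrec.nat_add.comp (Primrec.nat_mul.comp Primrec.succ Primrec.succ) Primrec.id
  · exact Primrec.list_cons.comp
      (Primrec.pair Primrec.option_some (Primrec.const true)) (Primrec.const _)
  · simp
  · simp [stepShift]

theorem map_atZero_le_closure_threeGen {h : ℕ → H} (hgen : GeneratesGroup h) :
    ((⊤ : Subgroup H).map (atZero H)).map (atZero _) ≤
      Subgroup.closure (Set.range (threeGen h)) := by
  rw [Subgroup.map_map, ← hgen, Subgroup.map_le_iff_le_comap, Subgroup.closure_le]
  rintro _ ⟨j, rfl⟩
  have hmem : ∀ i, threeGen h i ∈ Subgroup.closure (Set.range (threeGen h)) := fun i =>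
    Subgroup.subset_closure ⟨i, rfl⟩
  have hd : threeGen h (some true) = atZero _ (wreathGen (stepFun h) none) := by
    ext1
    · funext q
      by_cases hq : q = 1
      · subst hq
        simp [threeGen, wreathGen, sparseFun]
      · rw [atZero_left, Pi.mulSingle_eq_of_ne (M := fun _ => H ≀ᵣ Multiplicative ℤ) hq]
        exact if_neg (by simpa using hq)
    · rfl
  -- Conjugation by this power moves the value at `j ^ 2` to position `0`.
  let t : (H ≀ᵣ Multiplicative ℤ) ≀ᵣ Multiplicative ℤ := threeGen h none ^ (-((j * j : ℕ) : ℤ))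
  have ht : t = inl (Multiplicative.ofAdd (-((j * j : ℕ) : ℤ))) := by
    simp only [t, threeGen, wreathGen]
    rw [← map_zpow, ← ofAdd_zsmul, smul_eq_mul, mul_one]
  have htmem : t ∈ Subgroup.closure (Set.range (threeGen h)) := Subgroup.zpow_mem _ (hmem _) _
  let e := t * threeGen h (some false) * t⁻¹
  have he : e ∈ Subgroup.closure (Set.range (threeGen h)) :=
    Subgroup.mul_mem _ (Subgroup.mul_mem _ htmem (hmem _)) (Subgroup.inv_mem _ htmem)
  have her : e.right = 1 := by simp [e, threeGen, wreathGen]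
  have hel : e.left 1 = stepShift h j := by
    have := sparseFun_false_sq (wreathGen (stepFun h) none) (stepShift h) j
    simp only [e, ht, threeGen]
    generalize ((j * j : ℕ) : ℤ) = m at this ⊢
    simpa [wreathGen] using this
  have hc : ⁅threeGen h (some true), e⁆ ∈ Subgroup.closure (Set.range (threeGen h)) := by
    rw [commutatorElement_def]
    exact Subgroup.mul_mem _ (Subgroup.mul_mem _ (Subgroup.mul_mem _ (hmem _) he)
      (Subgroup.inv_mem _ (hmem _))) (Subgroup.inv_mem _ he)
  rw [hd, commutator_atZero _ her, hel, commutator_shift_stepShift, map_inv, map_inv,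
    inv_mem_iff] at hc
  exact hc

/-- A computable group embeds as a subnormal subgroup with decidable membership problem into a
finitely generated group with decidable word problem. -/
theorem IsComputableGroup.exists_embedding (hH : IsComputableGroup H) :
    ∃ (G : Subgroup ((H ≀ᵣ Multiplicative ℤ) ≀ᵣ Multiplicative ℤ)) (K : Subgroup G),
      Nonempty (H ≃* K) ∧ K.IsSubnormal ∧
        IsFGWithDecidableWordProblem G ∧ HasDecidableMembership K := by
  obtain ⟨h, hgen, hwp⟩ := hH
  let G := Subgroup.closure (Set.range (threeGen h))
  have hle := map_atZero_le_closure_threeGen hgen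
  let y : Fin 3 → G := fun i =>
    ⟨threeGen h (![none, some true, some false] i), Subgroup.subset_closure ⟨_, rfl⟩⟩
  have hrange : Set.range (fun i => (y i : (H ≀ᵣ Multiplicative ℤ) ≀ᵣ Multiplicative ℤ)) =
      Set.range (threeGen h) := by
    refine Function.Surjective.range_comp (f := ![none, some true, some false]) ?_ (threeGen h)
    rintro (_ | _ | _)
    exacts [⟨0, rfl⟩, ⟨2, rfl⟩, ⟨1, rfl⟩]
  have hy : GeneratesGroup y := by
    refine Subgroup.map_injective G.subtype_injective ?_
    rw [MonoidHom.map_closure, ← Set.range_comp, ← MonoidHom.range_eq_map, Subgroup.range_subtype]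
    exact congrArg Subgroup.closure hrange
  let ρ : List (Fin 3 × Bool) → List (Option Bool × Bool) := fun w =>
    w.map fun p => (![none, some true, some false] p.1, p.2)
  have hρ : Computable ρ := (Primrec.list_map Primrec.id
    ((Primrec.dom_finite fun p : Fin 3 × Bool =>
      ((![none, some true, some false] p.1, p.2) : Option Bool × Bool)).comp
        Primrec.snd).to₂).to_comp
  have hval : ∀ w, ((wordValue y w : G) : (H ≀ᵣ Multiplicative ℤ) ≀ᵣ Multiplicative ℤ) =
      wordValue (threeGen h) (ρ w) := fun w => by
    refine (map_wordValue G.subtype y w).trans ?_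
    simp [wordValue, ρ, y, Function.comp_def]
  refine ⟨G, (((⊤ : Subgroup H).map (atZero H)).map (atZero _)).subgroupOf G, ⟨?_⟩, ?_,
    ⟨3, y, hy, ?_⟩, ⟨3, y, hy, ?_⟩⟩
  · exact Subgroup.topEquiv.symm.trans <|
      ((⊤ : Subgroup H).equivMapOfInjective _ atZero_injective).trans <|
      (((⊤ : Subgroup H).map (atZero H)).equivMapOfInjective _ atZero_injective).trans
        (Subgroup.subgroupOfEquivOfLe hle).symm
  · exact (isSubnormal_map_atZero (isSubnormal_map_atZero .top)).subgroupOf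
  · refine ((computablePred_threeGen (M := ⊥) hwp (by simpa using hwp)).comp hρ).of_eq fun w => ?_
    rw [← hval]
    simp
  · refine ((computablePred_threeGen (M := ⊤) hwp ?_).comp hρ).of_eq fun w => ?_
    · simpa using (PrimrecPred.computablePred ⟨inferInstance, Primrec.const true⟩ :
        ComputablePred fun _ : List (ℕ × Bool) => True)
    · rw [← hval, Subgroup.mem_subgroupOf]

end Embedding

theorem corollary3 (H : Type u) [Group H] [Countable H] :
    (IsComputableGroup H ↔
      ∃ (G : Type v) (_ : Group G) (K : Subgroup G),
        Nonempty (H ≃* K) ∧ IsFGWithDecidableWordProblem G ∧ HasDecidableMembership K) ∧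
    (IsComputableGroup H ↔
      ∃ (G : Type v) (_ : Group G) (K : Subgroup G),
        Nonempty (H ≃* K) ∧ K.IsSubnormal ∧
          IsFGWithDecidableWordProblem G ∧ HasDecidableMembership K) := by
  have h23 : ∀ (G : Type v) [Group G] (K : Subgroup G), Nonempty (H ≃* K) →
      IsFGWithDecidableWordProblem G → HasDecidableMembership K → IsComputableGroup H := by
    rintro G _ K ⟨e⟩ hG hK
    exact (hK.isComputableGroup hG).of_mulEquiv e.symm
  have h13 : IsComputableGroup H → ∃ (G : Type v) (_ : Group G) (K : Subgroup G),
      Nonempty (H ≃* K) ∧ K.IsSubnormal ∧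
        IsFGWithDecidableWordProblem G ∧ HasDecidableMembership K := by
    intro hH
    obtain ⟨G, K, ⟨e⟩, hsn, hG, hK⟩ := hH.exists_embedding
    have := hG.countable
    -- The group constructed lives in the universe of `H`; being countable, it has a copy in any
    -- universe.
    have : Small.{v} G := Countable.toSmall G
    let σ : G ≃* Shrink.{v} G := Shrink.mulEquiv.symm
    exact ⟨Shrink.{v} G, inferInstance, K.map σ.toMonoidHom,
      ⟨e.trans (K.equivMapOfInjective _ σ.injective)⟩, hsn.map σ.surjective,
      hG.of_mulEquiv σ, hK.map σ⟩
  refine ⟨⟨fun hH => ?_, fun ⟨G, _, K, e, hG, hK⟩ => h23 G K e hG hK⟩,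
    ⟨h13, fun ⟨G, _, K, e, _, hG, hK⟩ => h23 G K e hG hK⟩⟩
  obtain ⟨G, _, K, e, -, hG, hK⟩ := h13 hH
  exact ⟨G, _, K, e, hG, hK⟩
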